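/- **Setting.** Paging with a finite set of $n$ pages and cache size $k\ge 1$: starting from a given initial cache of at most $k$ pages, after each request the cache must hold at most $k$ pages including the requested one, and each page moved into the cache costs $1$ (for an algorithm that loads pages only when they are requested, the cost is the number of page faults). $\mathrm{OPT}(\sigma)$ is the minimum cost of an offline solution for the request sequence $\sigma$, from the same initial cache. *RandomMark.* Initially all pages are unmarked. Each requested page is brought into the cache, if it is not there, and marked. If a page is requested that is not in the cache and the cache is full, then (after unmarking all pages, in case all pages in the cache are marked) a page chosen uniformly at random from the unmarked pages in the cache is evicted. *Randomly infused advice (RIA) with oracle $O_{ULFD}$ and infusion parameter $\alpha\in[0,1]$.* In each round, independently, with probability $\alpha$ the random content of the buffer from which RandomMark reads its random choice is replaced by advice of the oracle, which knows all of $\sigma$ and the answers so far; if a page has to be evicted in this round, the advice makes RandomMark evict an unmarked page in the cache whose next request is furthest in the future (a page never requested again counts as infinitely far; ties are broken arbitrarily). With probability $1-\alpha$ the choice is random as above. The algorithm is *$c$-competitive* (against an oblivious adversary) if there is a constant $b$ such that $\mathbb E[\mathrm{ALG}(\sigma)]\le c\cdot \mathrm{OPT}(\sigma)+b$ for every finite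 request sequence $\sigma$. **Theorem.** For every $k\ge1$, every initial cache and every $0\le\alpha\le1$, RandomMark with RIA and oracle $O_{ULFD}$ is $\min\{2H_k,\,2/\alpha\}$-competitive, where $H_k=\sum_{i=1}^k 1/i$ and $2/0=\infty$. Moreover, if $n=k+1$ and $\alpha=1$, it is $1$-competitive, that is, optimal up to an additive constant. -/

import Mathlib

open scoped NNReal ENNReal

noncomputable section

/-! ### Request-answer games and online algorithms with randomly infused advice -/

/-- A minimization request-answer game with requests `R` and answers `A`: the cost of an answer
sequence for a request sequence, where `⊤` is the cost of an infeasible answer sequence. -/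
structure RequestAnswerGame (R A : Type*) where
  cost : List R → List A → ℝ≥0∞

/-- The cost of an optimal offline solution. -/
def RequestAnswerGame.opt {R A : Type*} (G : RequestAnswerGame R A) (σ : List R) : ℝ≥0∞ :=
  ⨅ (l : List A) (_ : l.length = σ.length), G.cost σ l

/-- A (randomness-oblivious) online algorithm. `answer past ans r b` is the answer to the current
request `r`, given the earlier requests `past`, the earlier answers `ans` and the content `b` of
the buffer in the current round. The contents of the buffer in earlier rounds are not available.
Without advice, the buffer is uniform on the finite type `B` in each round. -/
structure OnlineAlgorithm (R A B : Type*) where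
  answer : List R → List A → R → B → A

/-- An oracle: for the entire request sequence `σ` and the answers `a₁, …, aᵢ₋₁` given so far, it
specifies the advice (a content of the buffer) for round `i`. -/
structure AdviceOracle (R A B : Type*) where
  advice : List R → List A → B

section RIA

variable {R A B : Type*} [Fintype B] [Nonempty B]

/-- The coin that decides whether the advice is infused: `true` with probability `α`. -/
def infusionCoin (α : ℝ≥0) (hα : α ≤ 1) : PMF Bool :=
  PMF.ofFintype (fun infused => if infused then (α : ℝ≥0∞) else 1 - (α : ℝ≥0∞)) (by simp [hα])

/-- The law of the buffer in one round: the advice `adv` with probability `α`, and uniformly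
random content with probability `1 - α`. -/
def bufferLaw (α : ℝ≥0) (hα : α ≤ 1) (adv : B) : PMF B :=
  (infusionCoin α hα).bind fun infused =>
    if infused then PMF.pure adv else PMF.uniformOfFintype B

/-- The law of the complete answer sequence on `σ`, when the requests `past` have already been
answered by `ans` and the requests in the last argument remain to be answered. The coins and the
random contents of the buffer are independent over the rounds. -/
def riaRunFrom (ALG : OnlineAlgorithm R A B) (O : AdviceOracle R A B) (α : ℝ≥0) (hα : α ≤ 1)
    (σ : List R) : List R → List A → List R → PMF (List A)
  | _, ans, [] => PMF.pure ans
  | past, ans, r :: rest =>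
      (bufferLaw α hα (O.advice σ ans)).bind fun b =>
        riaRunFrom ALG O α hα σ (past ++ [r]) (ans ++ [ALG.answer past ans r b]) rest

/-- The law of the answer sequence of `ALG`, assisted by `O` with infusion parameter `α`, on the
request sequence `σ`. -/
def riaRun (ALG : OnlineAlgorithm R A B) (O : AdviceOracle R A B) (α : ℝ≥0) (hα : α ≤ 1)
    (σ : List R) : PMF (List A) :=
  riaRunFrom ALG O α hα σ [] [] σ

/-- The expected cost of `ALG`, assisted by `O` with infusion parameter `α`, on `σ`. -/
def expectedCost (G : RequestAnswerGame R A) (ALG : OnlineAlgorithm R A B)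
    (O : AdviceOracle R A B) (α : ℝ≥0) (hα : α ≤ 1) (σ : List R) : ℝ≥0∞ :=
  ∑' l : List A, riaRun ALG O α hα σ l * G.cost σ l

/-- `ALG`, assisted by `O` with infusion parameter `α`, is `c`-competitive against an oblivious
adversary: the additive constant does not depend on the request sequence, which is fixed before
the random choices are made. -/
def IsCompetitive (G : RequestAnswerGame R A) (ALG : OnlineAlgorithm R A B)
    (O : AdviceOracle R A B) (α : ℝ≥0) (hα : α ≤ 1) (c : ℝ≥0∞) : Prop :=
  ∃ b : ℝ≥0, ∀ σ : List R, expectedCost G ALG O α hα σ ≤ c * G.opt σ + b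

end RIA

/-! ### Paging -/

section Paging

variable {P : Type*} [DecidableEq P]

/-- The cost of the sequence of cache contents in the last argument (the `i`-th one is the cache
after round `i`), starting from the cache `C`. After each round the cache has at most `k` pages
and contains the page requested in that round, and each page moved into the cache costs `1`. If
pages are moved into the cache only when they are requested, this is the number of page faults. -/
def pagingCost (k : ℕ) : Finset P → List P → List (Finset P) → ℝ≥0∞
  | _, [], [] => 0
  | C, r :: rs, D :: Ds =>
      if r ∈ D ∧ D.card ≤ k then ((D \ C).card : ℝ≥0∞) + pagingCost k D rs Ds else ⊤
  | _, _, _ => ⊤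

/-- The paging problem with page set `P`, cache size `k` and initial cache `C₀`. -/
def pagingGame (k : ℕ) (C₀ : Finset P) : RequestAnswerGame P (Finset P) where
  cost := pagingCost k C₀

/-- The marked pages at the moment when a page is chosen for eviction in a round with request `r`,
where `C` is the cache and `M` the set of marked pages before the round: if a page has to be
evicted and no page in the cache is unmarked, then all pages are unmarked. -/
def currentMarks (k : ℕ) (C M : Finset P) (r : P) : Finset P :=
  if r ∉ C ∧ k ≤ C.card ∧ C ⊆ M then ∅ else M

/-- The unmarked pages in the cache, from which the page to be evicted is chosen. -/
def unmarkedPages (k : ℕ) (C M : Finset P) (r : P) : Finset P :=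
  C \ currentMarks k C M r

/-- Replays requests and the caches after them, starting from the cache `C` and the set `M` of
marked pages, and returns the final cache and the final set of marked pages. Each requested page
is marked. -/
def markState (k : ℕ) :
    Finset P → Finset P → List P → List (Finset P) → Finset P × Finset P
  | C, M, r :: rs, D :: Ds => markState k D (insert r (currentMarks k C M r)) rs Ds
  | C, M, _, _ => (C, M)

/-- The content of the buffer used by RandomMark: a choice of a page from each nonempty set of
pages. A uniformly random content chooses a uniformly random page from each such set. -/
abbrev PageChoice (P : Type*) : Type _ :=
  (U : {U : Finset P // U.Nonempty}) → {p : P // p ∈ U.1}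

instance instNonemptyPageChoice (P : Type*) : Nonempty (PageChoice P) :=
  ⟨fun U => ⟨U.2.choose, U.2.choose_spec⟩⟩

/-- The cache of RandomMark after a round with request `r`, where `C` is the cache and `M` the set
of marked pages before the round, and `b` is the content of the buffer. -/
def randomMarkServe (k : ℕ) (C M : Finset P) (r : P) (b : PageChoice P) : Finset P :=
  if r ∈ C then C
  else if C.card < k then insert r C
  else if h : (unmarkedPages k C M r).Nonempty then
    insert r (C.erase (b ⟨unmarkedPages k C M r, h⟩).1)
  else insert r C

/-- RandomMark with cache size `k` and initial cache `C₀`, all pages being unmarked initially. -/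
def randomMark (k : ℕ) (C₀ : Finset P) : OnlineAlgorithm P (Finset P) (PageChoice P) where
  answer past ans r b :=
    randomMarkServe k (markState k C₀ ∅ past ans).1 (markState k C₀ ∅ past ans).2 r b

/-- The forward distance of page `p` with respect to the sequence of future requests: the number
of requests before its next request, or `⊤` if it is not requested any more. -/
def forwardDistance (future : List P) (p : P) : ℕ∞ :=
  if p ∈ future then (future.idxOf p : ℕ∞) else ⊤

/-- `O` is an unmarked longest-forward-distance oracle: in each round in which RandomMark has to
evict a page, the advised page has the longest forward distance among the unmarked pages in the
cache. Ties are broken arbitrarily. Here `past`, `r` and `future` are the earlier requests, the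
current request and the later requests, and `ans` are the answers given so far. -/
def IsULFDOracle (k : ℕ) (C₀ : Finset P)
    (O : AdviceOracle P (Finset P) (PageChoice P)) : Prop :=
  ∀ (past : List P) (r : P) (future : List P) (ans : List (Finset P)),
    ans.length = past.length →
    ∀ C M : Finset P, markState k C₀ ∅ past ans = (C, M) →
    r ∉ C → k ≤ C.card →
    ∀ h : (unmarkedPages k C M r).Nonempty,
    ∀ p ∈ unmarkedPages k C M r,
      forwardDistance future p ≤
        forwardDistance future
          (O.advice (past ++ r :: future) ans ⟨unmarkedPages k C M r, h⟩).1

end Paging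

end

/-! The phases, and hence the clean requests counted by `cleanCount`, do not depend on the random
choices, and both costs are compared with this count. Offline: up to an additive constant, the clean
requests number at most twice the offline cost (`cleanCount_add_le_two_mul_cost`). With only `k + 1`
pages, a phase that starts with `k` pages in `S` has at most one clean request, and each completed
phase together with the next request forces a load, so the factor drops to one
(`cleanCount_add_le_cost`). Online: a page evicted in the current phase carries potential `f j`,
where `j` is the number of unmarked cached pages requested after it. When it is requested again, all
`n` unmarked cached pages come later, so `f n` is released. This must pay for the fault and for the
potential of the newly evicted page, which is `f 0 = 0` under advice and at most the average of `f
0, ..., f (n - 1)` under a random choice: this is the recursion `FaultBound.step`. A clean request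
pays `F` instead. Hence the expected cost is at most `F` times the clean count
(`expectedCost_le_mul_cleanCount`). Both the harmonic numbers and the constant `1/α` (with `f 0 =
0`) satisfy the recursion. -/

noncomputable section

/-! ### Clean requests and lower bounds for the offline cost. -/

section Phases

variable {P : Type*} [DecidableEq P]

/-- The number of clean requests, that is, requests of pages that are neither marked nor in the
set `S` of pages that were in the cache when the current phase began. A phase ends as soon as `k`
pages are marked and an unmarked page is requested. -/
def cleanCount (k : ℕ) : Finset P → Finset P → List P → ℕ
  | _, _, [] => 0
  | S, M, r :: rs =>
      if k ≤ M.card ∧ r ∉ M then 1 + cleanCount k M {r} rs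
      else (if r ∉ M ∧ r ∉ S then 1 else 0) + cleanCount k S (insert r M) rs

theorem pagingCost_cons_eq_natCast {k : ℕ} {C D : Finset P} {r : P} {rs : List P}
    {Ds : List (Finset P)} {n : ℕ} (h : pagingCost k C (r :: rs) (D :: Ds) = n) :
    r ∈ D ∧ D.card ≤ k ∧ ∃ m : ℕ, pagingCost k D rs Ds = m ∧ n = (D \ C).card + m := by
  rw [pagingCost] at h
  split_ifs at h with hD
  · refine ⟨hD.1, hD.2, ?_⟩
    obtain ⟨m, hm'⟩ : ∃ m : ℕ, pagingCost k D rs Ds = m := by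
      refine ⟨n - (D \ C).card, ?_⟩
      rw [ENNReal.natCast_sub, ← h, ENNReal.add_sub_cancel_left (ENNReal.natCast_ne_top _)]
    refine ⟨m, hm', ?_⟩
    rw [hm'] at h
    exact_mod_cast h.symm
  · simp at h

theorem pagingCost_eq_top_or_natCast (k : ℕ) :
    ∀ (C : Finset P) (rs : List P) (Ds : List (Finset P)),
      pagingCost k C rs Ds = ⊤ ∨ ∃ n : ℕ, pagingCost k C rs Ds = n
  | _, [], [] => Or.inr ⟨0, by simp [pagingCost]⟩
  | _, [], _ :: _ => Or.inl (by simp [pagingCost])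
  | _, _ :: _, [] => Or.inl (by simp [pagingCost])
  | C, r :: rs, D :: Ds => by
      rw [pagingCost]
      split_ifs
      · rcases pagingCost_eq_top_or_natCast k D rs Ds with h | ⟨n, h⟩
        · left; simp [h]
        · right; exact ⟨(D \ C).card + n, by simp [h]⟩
      · exact Or.inl rfl

theorem card_union_le_add_card_sdiff {V C D : Finset P} (h : C ⊆ V) :
    (V ∪ D).card ≤ V.card + (D \ C).card := by
  have : V ∪ D ⊆ V ∪ (D \ C) := by
    intro x; simp only [Finset.mem_union, Finset.mem_sdiff]; have := @h x; tauto
  exact (Finset.card_le_card this).trans (Finset.card_union_le _ _)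

theorem card_union_sdiff_le_add_card_sdiff {V C D : Finset P} (S : Finset P) (h : C ⊆ V) :
    ((V ∪ D) \ S).card ≤ (V \ S).card + (D \ C).card := by
  have : (V ∪ D) \ S ⊆ (V \ S) ∪ (D \ C) := by
    intro x; simp only [Finset.mem_union, Finset.mem_sdiff]; have := @h x; tauto
  exact (Finset.card_le_card this).trans (Finset.card_union_le _ _)

/-- Within a phase, `(M \ S).card` is thus the number of clean requests served so far. -/
theorem card_insert_sdiff_eq (S M : Finset P) (r : P) :
    (insert r M \ S).card = (if r ∉ M ∧ r ∉ S then 1 else 0) + (M \ S).card := by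
  split_ifs with h
  · rw [Finset.insert_sdiff_of_notMem _ h.2, Finset.card_insert_of_notMem (by simp [h.1]),
      add_comm]
  · rw [zero_add]
    congr 1
    ext x
    simp only [Finset.mem_sdiff, Finset.mem_insert]
    grind

/-- In the invariant, `V` consists of the pages that were in the offline cache at some time in the
current phase. -/
theorem cleanCount_add_le_two_mul_cost (k : ℕ) (rs : List P) :
    ∀ (S M V C : Finset P) (Ds : List (Finset P)) (n : ℕ), M ⊆ V → C ⊆ V → C.card ≤ k →
      pagingCost k C rs Ds = n →
      cleanCount k S M rs + (M \ S).card ≤ 2 * n + (V \ S).card + V.card := by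
  induction rs with
  | nil =>
    intro S M V C Ds n hM _ _ _
    have := Finset.card_le_card (Finset.sdiff_subset_sdiff hM (le_refl S))
    rw [cleanCount]
    omega
  | cons r rs ih =>
    intro S M V C Ds n hM hC hk hn
    rcases Ds with _ | ⟨D, Ds⟩
    · simp [pagingCost] at hn
    obtain ⟨hr, hDk, m, hm, rfl⟩ := pagingCost_cons_eq_natCast hn
    rw [cleanCount]
    split_ifs with h
    -- A new phase starts. The old `V` contains `C ∪ M`, and `C.card ≤ k ≤ M.card`, so `V.card` pays
    -- for `(C \ M).card + C.card`, the starting value of the new potential before the current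
    -- loads; `(V \ S).card` pays for the old clean requests.
    · have h1 := ih M {r} (C ∪ D) D Ds m (by simp [hr]) Finset.subset_union_right hDk hm
      have h2 : (C ∪ D).card ≤ _ := card_union_le_add_card_sdiff (le_refl C)
      have h3 : ((C ∪ D) \ M).card ≤ _ := card_union_sdiff_le_add_card_sdiff M (le_refl C)
      have h4 := Finset.card_le_card (Finset.sdiff_subset_sdiff hM (le_refl S))
      have h5 := Finset.card_le_card (Finset.union_subset hC hM)
      have h6 : (C \ M).card + M.card = (C ∪ M).card := Finset.card_sdiff_add_card C M
      have h7 : (({r} : Finset P) \ M).card = 1 := by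
        rw [Finset.sdiff_eq_self_of_disjoint (by simp [h.2])]; simp
      omega
    all_goals
      -- Each load enlarges both `V` and `V \ S` by at most one page, whence the factor 2.
      have h1 := ih S (insert r M) (V ∪ D) D Ds m
        (Finset.insert_subset (by simp [hr]) (hM.trans Finset.subset_union_left))
        Finset.subset_union_right hDk hm
      have h2 := card_union_le_add_card_sdiff (D := D) hC
      have h3 := card_union_sdiff_le_add_card_sdiff (D := D) S hC
      have h4 := card_insert_sdiff_eq S M r
      simp only [*, if_true, if_false, not_false_eq_true, and_self] at h4
      omega

/-- In the invariant, `V` consists of the pages that were in the offline cache at some time in the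
current phase, after its first request. -/
theorem cleanCount_add_le_cost [Fintype P] (k : ℕ) (hP : Fintype.card P = k + 1) (rs : List P) :
    ∀ (S M V C : Finset P) (Ds : List (Finset P)) (n : ℕ), M ⊆ V → C ⊆ V → M.card ≤ k →
      pagingCost k C rs Ds = n →
      cleanCount k S M rs + (M \ S).card + S.card ≤ n + V.card + (k + 1) := by
  induction rs with
  | nil =>
    intro S M V C Ds n hM _ _ _
    have h1 := Finset.card_sdiff_add_card M S
    have h2 := Finset.card_le_univ (M ∪ S)
    rw [cleanCount]
    omega
  | cons r rs ih =>
    intro S M V C Ds n hM hC hk hn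
    rcases Ds with _ | ⟨D, Ds⟩
    · simp [pagingCost] at hn
    obtain ⟨hr, hDk, m, hm, rfl⟩ := pagingCost_cons_eq_natCast hn
    have h2 := card_union_le_add_card_sdiff (D := D) hC
    have h8 : insert r M ⊆ V ∪ D :=
      Finset.insert_subset (by simp [hr]) (hM.trans Finset.subset_union_left)
    have hu := Finset.card_sdiff_add_card M S
    have hu' := Finset.card_le_univ (M ∪ S)
    rw [cleanCount]
    split_ifs with h h'
    -- `V` restarts from `D`, so the load for the first request of a phase is charged to the phase
    -- before. With that request, `V ∪ D` contains at least `k + 1` pages, while `M ∪ S` has at most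
    -- `k + 1`.
    · have h1 := ih M {r} D D Ds m (by simp [hr]) (le_refl D) (by
        have : 0 < D.card := Finset.card_pos.2 ⟨r, hr⟩
        simp only [Finset.card_singleton]; omega) hm
      have h3 := Finset.card_le_card h8
      rw [Finset.card_insert_of_notMem h.2] at h3
      have h7 : (({r} : Finset P) \ M).card = 1 := by
        rw [Finset.sdiff_eq_self_of_disjoint (by simp [h.2])]; simp
      omega
    all_goals
      have h5 : (insert r M).card ≤ k := by
        by_cases hrM : r ∈ M
        · rwa [Finset.insert_eq_of_mem hrM]
        · rw [Finset.card_insert_of_notMem hrM]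
          have : ¬ k ≤ M.card := fun hc => h ⟨hc, hrM⟩
          omega
      have h1 := ih S (insert r M) (V ∪ D) D Ds m h8 Finset.subset_union_right h5 hm
      have h4 := card_insert_sdiff_eq S M r
      simp only [*, if_true, if_false, not_false_eq_true, and_self] at h4
      omega

theorem le_mul_opt_add {k : ℕ} {C₀ : Finset P} {σ : List P} {t c d : ℕ}
    (hc : c ≠ 0) (h : ∀ (Ds : List (Finset P)) (n : ℕ), pagingCost k C₀ σ Ds = n → t ≤ c * n + d) :
    (t : ℝ≥0∞) ≤ c * (pagingGame k C₀).opt σ + d := by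
  rw [RequestAnswerGame.opt, ENNReal.mul_iInf_of_ne (by exact_mod_cast hc) (by simp),
    ENNReal.iInf_add]
  refine le_iInf fun l => ?_
  rw [ENNReal.mul_iInf_of_ne (by exact_mod_cast hc) (by simp), ENNReal.iInf_add]
  refine le_iInf fun _ => ?_
  rcases pagingCost_eq_top_or_natCast k C₀ σ l with h' | ⟨n, h'⟩
  -- An infeasible solution costs `⊤`, and `c * ⊤ = ⊤` since `c ≠ 0`.
  · simp [pagingGame, h', ENNReal.mul_top, hc]
  · simp only [pagingGame, h']
    exact_mod_cast h l n h'

end Phases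

/-! ### Expectations over the buffer. -/

section Expectation

theorem PMF.tsum_bind_mul {X Y : Type*} (p : PMF X) (q : X → PMF Y) (g : Y → ℝ≥0∞) :
    ∑' y, p.bind q y * g y = ∑' x, p x * ∑' y, q x y * g y := by
  simp only [PMF.bind_apply, ← ENNReal.tsum_mul_right, ← ENNReal.tsum_mul_left, mul_assoc]
  exact ENNReal.tsum_comm

theorem PMF.tsum_pure_mul {Y : Type*} (a : Y) (g : Y → ℝ≥0∞) :
    ∑' y, PMF.pure a y * g y = g a := by
  rw [tsum_eq_single a]
  · simp
  · intro b hb; simp [PMF.pure_apply, hb]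

theorem tsum_bufferLaw_mul {B : Type*} [Fintype B] [Nonempty B] (α : ℝ≥0) (hα : α ≤ 1)
    (adv : B) (g : B → ℝ≥0∞) :
    ∑' b, bufferLaw α hα adv b * g b =
      α * g adv + (1 - (α : ℝ≥0∞)) * ((∑ b, g b) / Fintype.card B) := by
  rw [bufferLaw, PMF.tsum_bind_mul, tsum_bool]
  simp only [infusionCoin, PMF.ofFintype_apply, if_true, Bool.false_eq_true, if_false,
    PMF.tsum_pure_mul, PMF.uniformOfFintype_apply, ENNReal.tsum_mul_left]
  rw [add_comm, ENNReal.div_eq_inv_mul, tsum_fintype]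

/-- A coordinate of a uniformly random choice function is uniform: the other coordinates contribute
only a common factor. -/
theorem sum_pi_apply_div_card {ι : Type*} [Fintype ι] [DecidableEq ι] {β : ι → Type*}
    [∀ i, Fintype (β i)] [∀ i, Nonempty (β i)] (i : ι) (g : β i → ℝ≥0∞) :
    (∑ b : (∀ j, β j), g (b i)) / Fintype.card (∀ j, β j) = (∑ x, g x) / Fintype.card (β i) := by
  have h1 : ∑ b : (∀ j, β j), g (b i) =
      (Fintype.card (∀ j : {j // j ≠ i}, β j) : ℝ≥0∞) * ∑ x, g x := by
    rw [← (Equiv.piSplitAt i β).symm.sum_comp, Fintype.sum_prod_type]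
    simp [Equiv.piSplitAt, Finset.mul_sum]
  rw [h1, Fintype.card_congr (Equiv.piSplitAt i β), Fintype.card_prod, Nat.cast_mul,
    mul_comm (Fintype.card (β i) : ℝ≥0∞)]
  exact ENNReal.mul_div_mul_left _ _ (Nat.cast_ne_zero.2 Fintype.card_ne_zero)
    (ENNReal.natCast_ne_top _)

end Expectation

/-! ### Ranks of pages by their next request. -/

section Rank

variable {P : Type*} [DecidableEq P]

/-- The number of pages in `W` whose next request comes after that of `p`. -/
def laterCount (future : List P) (W : Finset P) (p : P) : ℕ :=
  (W.filter fun w => forwardDistance future p < forwardDistance future w).card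

theorem laterCount_mono (future : List P) {W W' : Finset P} (h : W ⊆ W') (p : P) :
    laterCount future W p ≤ laterCount future W' p :=
  Finset.card_le_card (Finset.filter_subset_filter _ h)

theorem forwardDistance_cons_self (r : P) (rs : List P) :
    forwardDistance (r :: rs) r = 0 := by
  simp [forwardDistance]

theorem forwardDistance_cons_of_ne {r p : P} (rs : List P) (h : p ≠ r) :
    forwardDistance (r :: rs) p = forwardDistance rs p + 1 := by
  rw [forwardDistance, forwardDistance]
  by_cases hp : p ∈ rs
  · simp [hp, List.idxOf_cons_ne rs h.symm]
  · simp [hp, h]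

theorem laterCount_cons_self {r : P} (rs : List P) {W : Finset P} (h : r ∉ W) :
    laterCount (r :: rs) W r = W.card := by
  rw [laterCount, Finset.filter_true_of_mem]
  intro w hw
  have hne : w ≠ r := fun e => h (e ▸ hw)
  rw [forwardDistance_cons_self, forwardDistance_cons_of_ne rs hne]
  simp

/-- Passing the request `r` shortens every other forward distance by one (`⊤` stays `⊤`), so the
order of the pages other than `r` is kept. -/
theorem laterCount_erase_le_cons {r p : P} (rs : List P) (W : Finset P) (h : p ≠ r) :
    laterCount rs (W.erase r) p ≤ laterCount (r :: rs) W p := by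
  refine Finset.card_le_card fun w hw => ?_
  simp only [Finset.mem_filter, Finset.mem_erase] at hw ⊢
  refine ⟨hw.1.2, ?_⟩
  rw [forwardDistance_cons_of_ne rs h, forwardDistance_cons_of_ne rs hw.1.1]
  exact (ENat.add_lt_add_iff_right (by simp)).2 hw.2

theorem laterCount_eq_zero {future : List P} {W : Finset P} {p : P}
    (h : ∀ w ∈ W, forwardDistance future w ≤ forwardDistance future p) :
    laterCount future W p = 0 := by
  rw [laterCount, Finset.card_eq_zero, Finset.filter_eq_empty_iff]
  exact fun w hw => not_lt.2 (h w hw)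

/-- Without ties the ranks would be exactly `0, ..., W.card - 1`; pages never requested again tie at
`⊤`, which only lowers ranks. The induction removes a page `q` requested first: it is later than no
page of `W`, so no rank changes. -/
theorem sum_laterCount_le (future : List P) {f : ℕ → ℝ≥0∞} (hf : Monotone f) (W : Finset P) :
    ∑ p ∈ W, f (laterCount future W p) ≤ ∑ i ∈ Finset.range W.card, f i := by
  induction hn : W.card generalizing W with
  | zero => simp [Finset.card_eq_zero.1 hn]
  | succ n ih =>
    obtain ⟨q, hq, hmin⟩ := W.exists_min_image (forwardDistance future)
      (Finset.card_pos.1 (by omega))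
    have hcard : (W.erase q).card = n := by rw [Finset.card_erase_of_mem hq]; omega
    rw [← Finset.sum_erase_add _ _ hq, Finset.sum_range_succ]
    have hsub : ∀ p ∈ W,
        laterCount future W p ≤ laterCount future (W.erase q) p := by
      intro p hp
      refine Finset.card_le_card fun w hw => ?_
      simp only [Finset.mem_filter, Finset.mem_erase] at hw ⊢
      refine ⟨⟨?_, hw.1⟩, hw.2⟩
      rintro rfl
      exact absurd hw.2 (not_lt.2 (hmin p hp))
    refine add_le_add ((Finset.sum_le_sum fun p hp => ?_).trans (ih _ hcard)) ?_
    · exact hf (hsub p (Finset.mem_of_mem_erase hp))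
    · refine hf ((hsub q hq).trans ?_)
      rw [← hcard]
      exact Finset.card_filter_le _ _

end Rank

/-! ### Invariant, potential and expected cost of RandomMark. -/

section RandomMark

variable {P : Type*} [DecidableEq P]

theorem markState_concat (k : ℕ) (r : P) (D : Finset P) :
    ∀ (past : List P) (ans : List (Finset P)) (C M : Finset P), ans.length = past.length →
      markState k C M (past ++ [r]) (ans ++ [D]) =
        (D, insert r (currentMarks k (markState k C M past ans).1
          (markState k C M past ans).2 r))
  | [], [], C, M, _ => by simp [markState]
  | q :: past, E :: ans, C, M, h => by
      simp only [List.cons_append, markState]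
      exact markState_concat k r D past ans _ _ (by simpa using h)

theorem pagingCost_concat (k : ℕ) {r : P} {D : Finset P} (hr : r ∈ D) (hD : D.card ≤ k) :
    ∀ (past : List P) (ans : List (Finset P)) (C M : Finset P), ans.length = past.length →
      pagingCost k C (past ++ [r]) (ans ++ [D]) =
        pagingCost k C past ans + ((D \ (markState k C M past ans).1).card : ℝ≥0∞)
  | [], [], C, M, _ => by simp [markState, pagingCost, hr, hD]
  | q :: past, E :: ans, C, M, h => by
      simp only [List.cons_append, markState, pagingCost]
      split_ifs
      · rw [pagingCost_concat k hr hD past ans E _ (by simpa using h), add_assoc]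
      · simp

/-- The properties of the cache `C` and the marked pages `M` of RandomMark that hold throughout a
phase that began with the cache `S`. -/
structure PhaseInvariant (k : ℕ) (S C M : Finset P) : Prop where
  marked_subset : M ⊆ C
  unmarked_subset : C \ M ⊆ S
  card_le : C.card ≤ k
  subset_of_card_lt : C.card < k → S ⊆ C

theorem PhaseInvariant.start {k : ℕ} {C : Finset P} (h : C.card ≤ k) :
    PhaseInvariant k C C ∅ :=
  ⟨by simp, by simp, h, fun _ => le_refl C⟩

/-- This matches the unmarking rule of the algorithm with the phase boundaries of `cleanCount`,
which do not mention the random cache. -/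
theorem PhaseInvariant.reset_iff {k : ℕ} {S C M : Finset P} (h : PhaseInvariant k S C M) (r : P) :
    (r ∉ C ∧ k ≤ C.card ∧ C ⊆ M) ↔ (k ≤ M.card ∧ r ∉ M) := by
  constructor
  · rintro ⟨h1, h2, h3⟩
    exact ⟨h2.trans (Finset.card_le_card h3), fun h' => h1 (h.marked_subset h')⟩
  · rintro ⟨h1, h2⟩
    have : M = C := Finset.eq_of_subset_of_card_le h.marked_subset (h.card_le.trans h1)
    subst this
    exact ⟨h2, h1, le_refl _⟩

/-- The potential of a state of RandomMark. Each page that was evicted in the current phase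
contributes the value of `f` at the number of unmarked pages in the cache that are requested
after it. -/
def evictedPotential (f : ℕ → ℝ≥0∞) (S C M : Finset P) (future : List P) : ℝ≥0∞ :=
  ∑ e ∈ S \ C, f (laterCount future (C \ M) e)

theorem PhaseInvariant.serve_hit {k : ℕ} {S C M : Finset P} (h : PhaseInvariant k S C M) {r : P}
    (hr : r ∈ C) : PhaseInvariant k S C (insert r M) where
  marked_subset := Finset.insert_subset hr h.marked_subset
  unmarked_subset := (Finset.sdiff_subset_sdiff (le_refl C) (Finset.subset_insert r M)).trans
    h.unmarked_subset
  card_le := h.card_le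
  subset_of_card_lt := h.subset_of_card_lt

theorem PhaseInvariant.serve_load {k : ℕ} {S C M : Finset P} (h : PhaseInvariant k S C M) {r : P}
    (hr : r ∉ C) (hC : C.card < k) : PhaseInvariant k S (insert r C) (insert r M) where
  marked_subset := Finset.insert_subset_insert r h.marked_subset
  unmarked_subset := by
    intro x hx
    have := @h.unmarked_subset x
    simp only [Finset.mem_sdiff, Finset.mem_insert] at hx this
    tauto
  card_le := by rw [Finset.card_insert_of_notMem hr]; omega
  subset_of_card_lt _ := (h.subset_of_card_lt hC).trans (Finset.subset_insert r C)

theorem card_insert_erase {C : Finset P} {r p : P} (hr : r ∉ C) (hp : p ∈ C) :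
    (insert r (C.erase p)).card = C.card := by
  rw [Finset.card_insert_of_notMem (fun h => hr (Finset.mem_of_mem_erase h)),
    Finset.card_erase_add_one hp]

theorem PhaseInvariant.serve_evict {k : ℕ} {S C M : Finset P} (h : PhaseInvariant k S C M)
    {r p : P} (hr : r ∉ C) (hC : k ≤ C.card) (hp : p ∈ C \ M) :
    PhaseInvariant k S (insert r (C.erase p)) (insert r M) where
  marked_subset := by
    intro x hx
    have := @h.marked_subset x
    simp only [Finset.mem_sdiff, Finset.mem_insert, Finset.mem_erase] at hx hp ⊢
    grind
  unmarked_subset := by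
    intro x hx
    have := @h.unmarked_subset x
    simp only [Finset.mem_sdiff, Finset.mem_insert, Finset.mem_erase] at hx this
    tauto
  card_le := by
    rw [card_insert_erase hr (Finset.mem_sdiff.1 hp).1]; exact h.card_le
  subset_of_card_lt h' := by
    rw [card_insert_erase hr (Finset.mem_sdiff.1 hp).1] at h'; omega

theorem evictedPotential_hit_le {f : ℕ → ℝ≥0∞} (hf : Monotone f) {S C M : Finset P} {r : P}
    (hr : r ∈ C) (rs : List P) :
    evictedPotential f S C (insert r M) rs ≤ evictedPotential f S C M (r :: rs) := by
  refine Finset.sum_le_sum fun e he => hf ?_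
  have hne : e ≠ r := by rintro rfl; exact (Finset.mem_sdiff.1 he).2 hr
  refine le_trans (laterCount_mono rs ?_ e) (laterCount_erase_le_cons rs (C \ M) hne)
  intro x
  simp only [Finset.mem_sdiff, Finset.mem_insert, Finset.mem_erase]
  tauto

/-- If `r` was evicted in this phase, every unmarked cached page is requested after it, so its share
of the potential is `f (C \ M).card`. -/
theorem sum_erase_add_eq_evictedPotential (f : ℕ → ℝ≥0∞) {S C M : Finset P} {r : P} (hr : r ∉ C)
    (rs : List P) :
    ∑ e ∈ (S \ C).erase r, f (laterCount (r :: rs) (C \ M) e) +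
      (if r ∈ S then f (C \ M).card else 0) = evictedPotential f S C M (r :: rs) := by
  rw [evictedPotential]
  split_ifs with hrS
  · rw [← Finset.sum_erase_add (S \ C) _ (Finset.mem_sdiff.2 ⟨hrS, hr⟩),
      laterCount_cons_self rs (by simp [hr])]
  · rw [Finset.erase_eq_of_notMem (by simp [hrS]), add_zero]

theorem evictedPotential_evict_le {k : ℕ} {f : ℕ → ℝ≥0∞} (hf : Monotone f) {S C M : Finset P}
    (h : PhaseInvariant k S C M) {r p : P} (hr : r ∉ C) (hp : p ∈ C \ M) (rs : List P) :
    evictedPotential f S (insert r (C.erase p)) (insert r M) rs ≤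
      ∑ e ∈ (S \ C).erase r, f (laterCount (r :: rs) (C \ M) e) +
        f (laterCount rs (C \ M) p) := by
  have hpC := (Finset.mem_sdiff.1 hp).1
  have hpS := h.unmarked_subset hp
  have hset : S \ insert r (C.erase p) = insert p ((S \ C).erase r) := by
    ext x
    simp only [Finset.mem_sdiff, Finset.mem_insert, Finset.mem_erase]
    grind
  have hW : insert r (C.erase p) \ insert r M ⊆ (C \ M).erase r := by
    intro x
    simp only [Finset.mem_sdiff, Finset.mem_insert, Finset.mem_erase]
    tauto
  rw [evictedPotential, hset, Finset.sum_insert (by simp [hpC]), add_comm]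
  refine add_le_add (Finset.sum_le_sum fun e he => hf ?_) (hf (laterCount_mono rs ?_ p))
  · exact (laterCount_mono rs hW e).trans
      (laterCount_erase_le_cons rs _ (Finset.ne_of_mem_erase he))
  · exact hW.trans (Finset.erase_subset _ _)

/-- `f` bounds the expected number of further faults caused by an evicted page, as a function of
the number of unmarked pages in the cache that are requested after it, and `F` bounds the values
of `f` for cache size `k`. -/
structure FaultBound (k : ℕ) (α : ℝ≥0) (f : ℕ → ℝ≥0∞) (F : ℝ≥0∞) : Prop where
  zero : f 0 = 0
  mono : Monotone f
  step : ∀ n, n ≠ 0 → 1 + (1 - (α : ℝ≥0∞)) * ((∑ i ∈ Finset.range n, f i) / n) ≤ f n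
  le : ∀ n ≤ k, f n ≤ F

/-- The expected cost of one round plus the expected potential after it. -/
theorem tsum_serve_le [Fintype P] {k : ℕ} (hk : 1 ≤ k) {α : ℝ≥0} (hα : α ≤ 1) {f : ℕ → ℝ≥0∞}
    {F : ℝ≥0∞} (hf : FaultBound k α f F) {S C M : Finset P} (h : PhaseInvariant k S C M) {r : P}
    (hno : ¬ (r ∉ C ∧ k ≤ C.card ∧ C ⊆ M)) (rs : List P) (adv : PageChoice P)
    (hadv : r ∉ C → k ≤ C.card → ∀ hW : (C \ M).Nonempty, ∀ p ∈ C \ M,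
      forwardDistance rs p ≤ forwardDistance rs (adv ⟨C \ M, hW⟩).1) :
    ∑' b, bufferLaw α hα adv b *
        (((randomMarkServe k C M r b \ C).card : ℝ≥0∞) +
          evictedPotential f S (randomMarkServe k C M r b) (insert r M) rs) ≤
      evictedPotential f S C M (r :: rs) + F * (if r ∉ M ∧ r ∉ S then 1 else 0 : ℕ) := by
  have hcur : unmarkedPages k C M r = C \ M := by rw [unmarkedPages, currentMarks, if_neg hno]
  have hconst : ∀ c : ℝ≥0∞, ∑' b, bufferLaw α hα adv b * c = c := fun c => by
    rw [ENNReal.tsum_mul_right, PMF.tsum_coe, one_mul]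
  have hF : 1 ≤ F := by
    refine le_trans ?_ (hf.le 1 hk)
    exact le_trans le_self_add (hf.step 1 one_ne_zero)
  by_cases hr : r ∈ C
  · have hs : ∀ b, randomMarkServe k C M r b = C := fun b => by rw [randomMarkServe, if_pos hr]
    simp only [hs, hconst]
    simp only [Finset.sdiff_self, Finset.card_empty, Nat.cast_zero, zero_add]
    exact (evictedPotential_hit_le hf.mono hr rs).trans le_self_add
  have hrM : r ∉ M := fun h' => hr (h.marked_subset h')
  by_cases hC : C.card < k
  · have hs : ∀ b, randomMarkServe k C M r b = insert r C := fun b => by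
      rw [randomMarkServe, if_neg hr, if_pos hC]
    simp only [hs, hconst]
    -- The cache is not full, so no page of `S` is missing: the potential vanishes and the request
    -- is clean, paying for its fault by `1 ≤ F`.
    have hS := h.subset_of_card_lt hC
    have hempty : S \ insert r C = ∅ :=
      Finset.sdiff_eq_empty_iff_subset.2 (hS.trans (Finset.subset_insert r C))
    rw [evictedPotential, hempty, Finset.sum_empty, add_zero,
      if_pos ⟨hrM, fun h' => hr (hS h')⟩, Finset.insert_sdiff_of_notMem _ hr]
    simp only [Finset.sdiff_self, insert_empty_eq, Finset.card_singleton, Nat.cast_one, mul_one]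
    exact hF.trans le_add_self
  rw [not_lt] at hC
  have hW : (C \ M).Nonempty := by
    rw [Finset.sdiff_nonempty]
    exact fun h' => hno ⟨hr, hC, h'⟩
  have hs : ∀ b, randomMarkServe k C M r b = insert r (C.erase (b ⟨C \ M, hW⟩).1) := fun b => by
    rw [randomMarkServe, if_neg hr, if_neg (not_lt.2 hC)]
    have hU : ∀ (U : Finset P) (hU : U.Nonempty), unmarkedPages k C M r = U →
        (if h : (unmarkedPages k C M r).Nonempty then
          insert r (C.erase (b ⟨unmarkedPages k C M r, h⟩).1) else insert r C) =
        insert r (C.erase (b ⟨U, hU⟩).1) := by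
      rintro U hU rfl
      rw [dif_pos hU]
    exact hU _ hW hcur
  set X : ℝ≥0∞ := if r ∈ S then f (C \ M).card else 0 with hX
  set n := (C \ M).card with hn
  have hn0 : n ≠ 0 := (Finset.card_pos.2 hW).ne'
  have hnk : n ≤ k := (Finset.card_le_card Finset.sdiff_subset).trans h.card_le
  have hone : ∀ b : PageChoice P, ((randomMarkServe k C M r b \ C).card : ℝ≥0∞) = 1 := fun b => by
    have : randomMarkServe k C M r b \ C = {r} := by
      rw [hs]; ext x
      simp only [Finset.mem_sdiff, Finset.mem_insert, Finset.mem_erase, Finset.mem_singleton]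
      grind
    simp [this]
  -- The advised page has rank 0 and contributes `f 0 = 0`; only the random branch, of weight `1 -
  -- α`, remains.
  have hmean : ∑' b, bufferLaw α hα adv b * f (laterCount rs (C \ M) (b ⟨C \ M, hW⟩).1) ≤
      (1 - (α : ℝ≥0∞)) * ((∑ i ∈ Finset.range n, f i) / n) := by
    rw [tsum_bufferLaw_mul, laterCount_eq_zero (hadv hr hC hW), hf.zero, mul_zero, zero_add]
    have : ∀ U : {U : Finset P // U.Nonempty}, Nonempty {p : P // p ∈ U.1} :=
      fun U => ⟨⟨U.2.choose, U.2.choose_spec⟩⟩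
    have hpi := sum_pi_apply_div_card
      (β := fun U : {U : Finset P // U.Nonempty} => {p : P // p ∈ U.1})
      ⟨C \ M, hW⟩ (fun p => f (laterCount rs (C \ M) p.1))
    rw [hpi, Fintype.card_coe, Finset.sum_coe_sort (C \ M) fun p => f (laterCount rs (C \ M) p)]
    gcongr
    exact sum_laterCount_le rs hf.mono _
  -- The fault and the new potential cost at most `f n`: released by `r` if `r ∈ S`, and covered by
  -- `F` if the request is clean.
  have hX : 1 + ∑' b, bufferLaw α hα adv b * f (laterCount rs (C \ M) (b ⟨C \ M, hW⟩).1) ≤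
      (if r ∈ S then f n else 0) + F * (if r ∉ M ∧ r ∉ S then 1 else 0 : ℕ) := by
    refine (add_le_add (le_refl _) hmean).trans ((hf.step n hn0).trans ?_)
    by_cases hrS : r ∈ S
    · simp [hrS]
    · simp [hrS, hrM, hf.le n hnk]
  set Y := ∑ e ∈ (S \ C).erase r, f (laterCount (r :: rs) (C \ M) e) with hY
  calc _ ≤ ∑' b, bufferLaw α hα adv b *
        ((Y + 1) + f (laterCount rs (C \ M) (b ⟨C \ M, hW⟩).1)) := by
        refine ENNReal.tsum_le_tsum fun b => mul_le_mul_right ?_ _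
        rw [hone, hs, add_comm Y, add_assoc]
        gcongr
        exact evictedPotential_evict_le hf.mono h hr (b ⟨C \ M, hW⟩).2 rs
    _ = Y + (1 + ∑' b, bufferLaw α hα adv b *
        f (laterCount rs (C \ M) (b ⟨C \ M, hW⟩).1)) := by
        simp only [mul_add _ (Y + 1)]
        rw [ENNReal.tsum_add, hconst, add_assoc]
    _ ≤ _ := by
        rw [← sum_erase_add_eq_evictedPotential f hr rs, add_assoc]
        gcongr

theorem PhaseInvariant.serve {k : ℕ} {S C M : Finset P} (h : PhaseInvariant k S C M) {r : P}
    (hno : ¬ (r ∉ C ∧ k ≤ C.card ∧ C ⊆ M)) (b : PageChoice P) :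
    r ∈ randomMarkServe k C M r b ∧
      PhaseInvariant k S (randomMarkServe k C M r b) (insert r M) := by
  have hcur : unmarkedPages k C M r = C \ M := by rw [unmarkedPages, currentMarks, if_neg hno]
  rw [randomMarkServe]
  split_ifs with hr hC hW
  · exact ⟨hr, h.serve_hit hr⟩
  · exact ⟨by simp, h.serve_load hr hC⟩
  · refine ⟨by simp, h.serve_evict hr (not_lt.1 hC) ?_⟩
    rw [← hcur]
    exact (b _).2
  · rw [hcur, Finset.sdiff_nonempty, not_not] at hW
    exact absurd ⟨hr, not_lt.1 hC, hW⟩ hno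

/-- Unmarking all pages at the end of a phase does not change how a request is served. -/
theorem randomMarkServe_currentMarks (k : ℕ) (C M : Finset P) (r : P) (b : PageChoice P) :
    randomMarkServe k C (currentMarks k C M r) r b = randomMarkServe k C M r b := by
  have : currentMarks k C (currentMarks k C M r) r = currentMarks k C M r := by
    by_cases h : r ∉ C ∧ k ≤ C.card ∧ C ⊆ M <;> simp [currentMarks, h]
  unfold randomMarkServe unmarkedPages
  rw [this]

/-- The cost so far, plus the potential, plus `F` per remaining clean request does not increase in
expectation. -/
theorem tsum_riaRunFrom_le [Fintype P] {k : ℕ} (hk : 1 ≤ k) {C₀ : Finset P}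
    {O : AdviceOracle P (Finset P) (PageChoice P)} (hO : IsULFDOracle k C₀ O) {α : ℝ≥0}
    (hα : α ≤ 1) {f : ℕ → ℝ≥0∞} {F : ℝ≥0∞} (hf : FaultBound k α f F) (σ : List P)
    (rest : List P) :
    ∀ (past : List P) (ans : List (Finset P)) (S C M : Finset P), σ = past ++ rest →
      ans.length = past.length → markState k C₀ ∅ past ans = (C, M) → PhaseInvariant k S C M →
      ∑' l, riaRunFrom (randomMark k C₀) O α hα σ past ans rest l * pagingCost k C₀ σ l ≤
        pagingCost k C₀ past ans +
          (evictedPotential f S C M rest + F * cleanCount k S M rest) := by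
  induction rest with
  | nil =>
    intro past ans S C M hσ _ _ _
    rw [riaRunFrom, PMF.tsum_pure_mul, hσ, List.append_nil]
    exact le_self_add
  | cons r rs ih =>
    intro past ans S C M hσ hlen hst hinv
    -- `S'` is `C` if a phase starts now, and `S` otherwise. At a start `S' \ C` is empty, so the
    -- potential drops to 0; no second reset is due because `1 ≤ k` makes the full cache nonempty.
    obtain ⟨S', hinv', hno, hpot, hclean⟩ : ∃ S', PhaseInvariant k S' C (currentMarks k C M r) ∧
        ¬ (r ∉ C ∧ k ≤ C.card ∧ C ⊆ currentMarks k C M r) ∧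
        evictedPotential f S' C (currentMarks k C M r) (r :: rs) ≤
          evictedPotential f S C M (r :: rs) ∧
        cleanCount k S M (r :: rs) =
          (if r ∉ currentMarks k C M r ∧ r ∉ S' then 1 else 0) +
            cleanCount k S' (insert r (currentMarks k C M r)) rs := by
      by_cases hreset : r ∉ C ∧ k ≤ C.card ∧ C ⊆ M
      · have hMC : M = C := hinv.marked_subset.antisymm hreset.2.2
        refine ⟨C, ?_, ?_, ?_, ?_⟩ <;> simp only [currentMarks, if_pos hreset]
        · exact PhaseInvariant.start hinv.card_le
        · rintro ⟨-, h1, h2⟩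
          rw [Finset.subset_empty.1 h2, Finset.card_empty] at h1
          omega
        · simp [evictedPotential]
        · rw [cleanCount, if_pos ((hinv.reset_iff r).1 hreset), hMC]
          simp [hreset.1]
      · refine ⟨S, ?_, ?_, ?_, ?_⟩ <;> simp only [currentMarks, if_neg hreset]
        · exact hinv
        · exact hreset
        · exact le_refl _
        · rw [cleanCount, if_neg (mt (hinv.reset_iff r).2 hreset)]
    set N := currentMarks k C M r with hN
    set adv := O.advice σ ans with hadv
    have hadv' : r ∉ C → k ≤ C.card → ∀ hW : (C \ N).Nonempty, ∀ p ∈ C \ N,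
        forwardDistance rs p ≤ forwardDistance rs (adv ⟨C \ N, hW⟩).1 := by
      intro h1 h2 hW p hp
      rw [hadv, hσ]
      exact hO past r rs ans hlen C M hst h1 h2 hW p hp
    have hans : ∀ b, (randomMark k C₀).answer past ans r b = randomMarkServe k C N r b := by
      intro b
      rw [randomMarkServe_currentMarks k C M r b]
      simp only [randomMark, hst]
    rw [riaRunFrom, PMF.tsum_bind_mul, hclean]
    set K := F * cleanCount k S' (insert r N) rs with hK
    calc _ ≤ ∑' b, bufferLaw α hα adv b * ((pagingCost k C₀ past ans + K) +
          (((randomMarkServe k C N r b \ C).card : ℝ≥0∞) +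
            evictedPotential f S' (randomMarkServe k C N r b) (insert r N) rs)) := by
          refine ENNReal.tsum_le_tsum fun b => mul_le_mul_right ?_ _
          rw [hans]
          obtain ⟨hr, hinv''⟩ := hinv'.serve hno b
          refine (ih (past ++ [r]) (ans ++ [randomMarkServe k C N r b]) S'
            (randomMarkServe k C N r b) (insert r N) (by simp [hσ]) (by simp [hlen])
            (by rw [markState_concat k r _ past ans C₀ ∅ hlen, hst]) hinv'').trans ?_
          rw [pagingCost_concat k hr hinv''.card_le past ans C₀ ∅ hlen, hst]
          apply le_of_eq
          ring
      _ = (pagingCost k C₀ past ans + K) + ∑' b, bufferLaw α hα adv b *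
          (((randomMarkServe k C N r b \ C).card : ℝ≥0∞) +
            evictedPotential f S' (randomMarkServe k C N r b) (insert r N) rs) := by
          simp only [mul_add _ (pagingCost k C₀ past ans + K)]
          rw [ENNReal.tsum_add, ENNReal.tsum_mul_right, PMF.tsum_coe, one_mul]
      _ ≤ (pagingCost k C₀ past ans + K) + (evictedPotential f S C M (r :: rs) +
          F * (if r ∉ N ∧ r ∉ S' then 1 else 0 : ℕ)) := by
          gcongr
          exact (tsum_serve_le hk hα hf hinv' hno rs adv hadv').trans (by gcongr)
      _ = _ := by
          rw [hK]
          push_cast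
          ring

theorem expectedCost_le_mul_cleanCount [Fintype P] {k : ℕ} (hk : 1 ≤ k) {C₀ : Finset P}
    (hC₀ : C₀.card ≤ k) {O : AdviceOracle P (Finset P) (PageChoice P)}
    (hO : IsULFDOracle k C₀ O) {α : ℝ≥0} (hα : α ≤ 1) {f : ℕ → ℝ≥0∞} {F : ℝ≥0∞}
    (hf : FaultBound k α f F) (σ : List P) :
    expectedCost (pagingGame k C₀) (randomMark k C₀) O α hα σ ≤ F * cleanCount k C₀ ∅ σ := by
  have h := tsum_riaRunFrom_le hk hO hα hf σ σ [] [] C₀ C₀ ∅ rfl rfl rfl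
    (PhaseInvariant.start hC₀)
  simpa [expectedCost, riaRun, pagingGame, pagingCost, evictedPotential] using h

/-! ### Two solutions of the fault recursion, and the competitive ratios. -/

theorem faultBound_harmonic (k : ℕ) (α : ℝ≥0) :
    FaultBound k α (fun n => ENNReal.ofReal (harmonic n : ℝ))
      (ENNReal.ofReal (harmonic k : ℝ)) := by
  have hmono : Monotone fun n => ((harmonic n : ℚ) : ℝ) := by
    refine monotone_nat_of_le_succ fun n => ?_
    rw [harmonic_succ]
    push_cast
    have : (0 : ℝ) ≤ ((n : ℝ) + 1)⁻¹ := by positivity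
    linarith
  have hnonneg : ∀ n, (0 : ℝ) ≤ (harmonic n : ℚ) := fun n => by simpa using hmono n.zero_le
  have hsum : ∀ n : ℕ, ∑ i ∈ Finset.range n, ((harmonic i : ℚ) : ℝ) = n * (harmonic n : ℚ) - n := by
    intro n
    induction n with
    | zero => simp
    | succ n ih =>
      rw [Finset.sum_range_succ, ih, harmonic_succ]
      push_cast
      field_simp
      ring
  refine ⟨by simp, fun a b hab => ENNReal.ofReal_le_ofReal (hmono hab), fun n hn => ?_,
    fun n hn => ENNReal.ofReal_le_ofReal (hmono hn)⟩
  -- After bounding `1 - α` by 1, `hsum` gives equality: `1 + (H_n - 1) = H_n`.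
  refine (add_le_add (le_refl _) (mul_le_of_le_one_left' tsub_le_self)).trans (le_of_eq ?_)
  have hn' : (0 : ℝ) < n := by positivity
  rw [← ENNReal.ofReal_sum_of_nonneg (fun i _ => hnonneg i), hsum, ← ENNReal.ofReal_natCast n,
    ← ENNReal.ofReal_div_of_pos hn', ← ENNReal.ofReal_one, ← ENNReal.ofReal_add zero_le_one]
  · congr 1
    field_simp
    ring
  · rw [← hsum]
    exact div_nonneg (Finset.sum_nonneg fun i _ => hnonneg i) hn'.le

/-- The average is at most `1/α`, and `1 + (1 - α)/α = 1/α`: an evicted page causes faults until the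
first advised eviction, a geometric waiting time. -/
theorem faultBound_inv (k : ℕ) {α : ℝ≥0} (hα0 : α ≠ 0) (hα : α ≤ 1) :
    FaultBound k α (fun n => if n = 0 then 0 else (α : ℝ≥0∞)⁻¹) (α : ℝ≥0∞)⁻¹ := by
  refine ⟨by simp, fun a b hab => ?_, fun n hn => ?_, fun n _ => ?_⟩
  · split_ifs with h1 h2 <;> first | omega | simp
  · have hα0' : (α : ℝ≥0∞) ≠ 0 := by exact_mod_cast hα0
    have hle : (∑ i ∈ Finset.range n, if i = 0 then 0 else (α : ℝ≥0∞)⁻¹) / n ≤ (α : ℝ≥0∞)⁻¹ := by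
      refine ENNReal.div_le_of_le_mul' ?_
      refine (Finset.sum_le_card_nsmul _ _ (α : ℝ≥0∞)⁻¹ fun i _ => ?_).trans (by simp)
      split_ifs <;> simp
    rw [if_neg hn]
    calc _ ≤ 1 + (1 - (α : ℝ≥0∞)) * (α : ℝ≥0∞)⁻¹ := by gcongr
      _ = ((α : ℝ≥0∞) + (1 - (α : ℝ≥0∞))) * (α : ℝ≥0∞)⁻¹ := by
          rw [add_mul, ENNReal.mul_inv_cancel hα0' ENNReal.coe_ne_top]
      _ = _ := by
          rw [add_tsub_cancel_of_le (by exact_mod_cast hα), one_mul]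
  · split_ifs <;> simp

theorem isCompetitive_of_faultBound [Fintype P] {k : ℕ} (hk : 1 ≤ k) {C₀ : Finset P}
    (hC₀ : C₀.card ≤ k) {O : AdviceOracle P (Finset P) (PageChoice P)}
    (hO : IsULFDOracle k C₀ O) {α : ℝ≥0} (hα : α ≤ 1) {f : ℕ → ℝ≥0∞} {F : ℝ≥0∞}
    (hf : FaultBound k α f F) (hF : F ≠ ⊤) {c d : ℕ} (hc : c ≠ 0)
    (h : ∀ (σ : List P) (Ds : List (Finset P)) (n : ℕ), pagingCost k C₀ σ Ds = n →
      cleanCount k C₀ ∅ σ ≤ c * n + d) :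
    IsCompetitive (pagingGame k C₀) (randomMark k C₀) O α hα (c * F) := by
  refine ⟨(F * d).toNNReal, fun σ => ?_⟩
  rw [ENNReal.coe_toNNReal (ENNReal.mul_ne_top hF (ENNReal.natCast_ne_top d))]
  calc _ ≤ F * cleanCount k C₀ ∅ σ := expectedCost_le_mul_cleanCount hk hC₀ hO hα hf σ
    _ ≤ F * (c * (pagingGame k C₀).opt σ + d) := by
        gcongr
        exact le_mul_opt_add hc (h σ)
    _ = _ := by ring

end RandomMark

end

theorem mainTheorem1 {P : Type*} [Fintype P] [DecidableEq P] (k : ℕ) (hk : 1 ≤ k)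
    (C₀ : Finset P) (hC₀ : C₀.card ≤ k)
    (O : AdviceOracle P (Finset P) (PageChoice P)) (hO : IsULFDOracle k C₀ O)
    (α : ℝ≥0) (hα : α ≤ 1) :
    IsCompetitive (pagingGame k C₀) (randomMark k C₀) O α hα
        (min (2 * ENNReal.ofReal (harmonic k : ℝ)) (2 / (α : ℝ≥0∞))) ∧
      (Fintype.card P = k + 1 → α = 1 →
        IsCompetitive (pagingGame k C₀) (randomMark k C₀) O α hα 1) := by
  have htwo : ∀ (σ : List P) (Ds : List (Finset P)) (n : ℕ), pagingCost k C₀ σ Ds = n →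
      cleanCount k C₀ ∅ σ ≤ 2 * n + C₀.card := fun σ Ds n hn => by
    simpa using cleanCount_add_le_two_mul_cost k σ C₀ ∅ C₀ C₀ Ds n (by simp) (le_refl _) hC₀ hn
  refine ⟨?_, fun hP h1 => ?_⟩
  · rcases min_choice (2 * ENNReal.ofReal (harmonic k : ℝ)) (2 / (α : ℝ≥0∞)) with h | h
    · rw [h]
      exact_mod_cast isCompetitive_of_faultBound hk hC₀ hO hα (faultBound_harmonic k α)
        ENNReal.ofReal_ne_top two_ne_zero htwo
    · rcases eq_or_ne α 0 with rfl | hα0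
      -- For `α = 0` the second term is `⊤`, so it cannot be the minimum.
      · have h' : 2 * ENNReal.ofReal (harmonic k : ℝ) ≠ ⊤ :=
          ENNReal.mul_ne_top (by simp) ENNReal.ofReal_ne_top
        rw [ENNReal.coe_zero, ENNReal.div_zero two_ne_zero, min_top_right] at h
        exact absurd h h'
      · rw [h, div_eq_mul_inv]
        exact_mod_cast isCompetitive_of_faultBound hk hC₀ hO hα (faultBound_inv k hα0 hα)
          (ENNReal.inv_ne_top.2 (by exact_mod_cast hα0)) two_ne_zero htwo
  · subst h1
    have hone : ∀ (σ : List P) (Ds : List (Finset P)) (n : ℕ), pagingCost k C₀ σ Ds = n →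
        cleanCount k C₀ ∅ σ ≤ 1 * n + (k + 1) := fun σ Ds n hn => by
      -- With `S = V = C₀` the two terms `C₀.card` cancel, leaving the additive constant `k + 1`.
      have := cleanCount_add_le_cost k hP σ C₀ ∅ C₀ C₀ Ds n (by simp) (le_refl _) (by simp) hn
      simp only [Finset.empty_sdiff, Finset.card_empty] at this
      omega
    simpa using isCompetitive_of_faultBound hk hC₀ hO hα (faultBound_inv k one_ne_zero hα)
      (by simp) one_ne_zero hone
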